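/- A graph $G$ is called a \emph{diameter graph} in $\mathbb{R}^d$ if its vertices can be assigned to distinct points of (Euclidean) $\mathbb{R}^d$ in such a way that any two adjacent vertices are assigned to points whose distance is the maximum distance between any two of the assigned points (it is not required that every pair of points at maximum distance is an edge). The girth of a graph is the length of its shortest cycle, and is $\infty$ if there is no cycle; $\chi(G)$ denotes the chromatic number of $G$. \textbf{Theorem.} There is a sequence of real numbers $(\varepsilon_d)_{d\ge 0}$ with $\varepsilon_d\to 0$ as $d\to\infty$ such that for every non-negative integer $d$ and every non-negative integer $g$ there exists a finite diameter graph $G$ in $\mathbb{R}^d$ with girth at least $g$ and $$\chi(G)\ \ge\ (1.107+\varepsilon_d)^{\sqrt d}.$$ -/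

import Mathlib

/-- `G` is a diameter graph in `ℝ^d`: its vertices can be assigned to distinct points of Euclidean
`d`-space so that any two adjacent vertices are assigned to points at the maximum distance among
all assigned points. (Non-adjacent vertices may also be at the maximum distance.) -/
def IsDiameterGraph {V : Type*} (d : ℕ) (G : SimpleGraph V) : Prop :=
  ∃ f : V → EuclideanSpace ℝ (Fin d), Function.Injective f ∧
    ∀ u v : V, G.Adj u v → ∀ x y : V, dist (f x) (f y) ≤ dist (f u) (f v)

open Finset

/-! ### Greedy edge insertion: large girth against a counting bound on proper colourings. -/

namespace SimpleGraph

/-! For complex vectors z, w of equal norm, the matrices zzᴴ and wwᴴ are as far apart as such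
matrices can be when z ⟂ w (`dist_hermitianPoint_sq`). Hermitian matrices of order n + 1 form a real
space of dimension (n + 1)², so orthogonality graphs become diameter graphs there. Prepending a
coordinate 1 to sign vectors turns inner product -1 into orthogonality.

The chromatic number of `signGraph` with s = p - 1 is large by the polynomial method modulo p: an
independent set is no larger than the number of monomials of degree at most p - 1 with exponents in
{0, 1, 2}. For n = 4a and a prime a < p ≤ 2a this yields about 1.5236 ^ a colours, and 1.5236 ^
(1/4) > 1.107 leaves room for polynomial factors and for rounding √d.

Girth comes from phases. Rotating coordinate j of both endpoints by the same phase θ j preserves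
orthogonality, so each θ gives a copy of the graph, and every K-colouring of the union has a
monochromatic pair in each copy. As p - 1 is even, adjacent vectors have different supports; hence a
pair of vertices lies in far fewer copies than a single vertex. With many phases, edges can then be
added one at a time (`exists_le_egirth_not_colorable`, `exists_sparse_lift`), creating no short
cycle and removing a fixed fraction of the remaining proper colourings each time, until none is
left. -/

theorem exists_walks_of_mem_edges_sup_edge {V : Type*} {G : SimpleGraph V} {u v : V} {a b : V}
    (p : (G ⊔ edge u v).Walk a b) (hp : p.edges.Nodup) (h : s(u, v) ∈ p.edges) :
    (∃ (q₁ : G.Walk a u) (q₂ : G.Walk v b), q₁.length + q₂.length + 1 = p.length) ∨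
    (∃ (q₁ : G.Walk a v) (q₂ : G.Walk u b), q₁.length + q₂.length + 1 = p.length) := by
  induction p with
  | nil => simp at h
  | @cons a c b hac q ih =>
    rw [Walk.edges_cons, List.nodup_cons] at hp
    by_cases he : s(a, c) = s(u, v)
    · have hq : ∀ e ∈ q.edges, e ∈ G.edgeSet := by
        intro e heq
        have h1 := q.edges_subset_edgeSet heq
        have h2 : e ≠ s(u, v) := fun h' => hp.1 (by rw [he, ← h']; exact heq)
        induction e with | _ x y =>
        rw [mem_edgeSet, sup_adj, edge_adj] at h1
        rcases h1 with h1 | ⟨h1, -⟩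
        · exact h1
        · exact (h2 (by rw [Sym2.eq_iff]; tauto)).elim
      rw [Sym2.eq_iff] at he
      rcases he with ⟨rfl, rfl⟩ | ⟨rfl, rfl⟩
      · exact Or.inl ⟨Walk.nil, q.transfer G hq, by simp⟩
      · exact Or.inr ⟨Walk.nil, q.transfer G hq, by simp⟩
    · have hG : G.Adj a c := by
        rw [sup_adj, edge_adj] at hac
        rcases hac with h1 | ⟨h1, -⟩
        · exact h1
        · exact (he (by rw [Sym2.eq_iff]; tauto)).elim
      have h' : s(u, v) ∈ q.edges := by
        rw [Walk.edges_cons, List.mem_cons] at h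
        exact h.resolve_left (fun h => he h.symm)
      rcases ih hp.2 h' with ⟨q₁, q₂, hl⟩ | ⟨q₁, q₂, hl⟩
      · exact Or.inl ⟨Walk.cons hG q₁, q₂, by simp only [Walk.length_cons]; omega⟩
      · exact Or.inr ⟨Walk.cons hG q₁, q₂, by simp only [Walk.length_cons]; omega⟩

/-- A cycle through the new edge becomes, once that edge is removed, a walk of `G` between its ends;
every other cycle already lies in `G`. -/
theorem le_egirth_sup_edge {V : Type*} {G : SimpleGraph V} {u v : V} {g : ℕ}
    (hG : (g : ℕ∞) ≤ G.egirth) (h : ∀ q : G.Walk u v, g ≤ q.length) :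
    (g : ℕ∞) ≤ (G ⊔ edge u v).egirth := by
  rw [le_egirth] at hG ⊢
  intro a w hw
  by_cases he : s(u, v) ∈ w.edges
  · rcases exists_walks_of_mem_edges_sup_edge w hw.edges_nodup he with
      ⟨q₁, q₂, hl⟩ | ⟨q₁, q₂, hl⟩
    · have := h (q₂.append q₁).reverse
      rw [Walk.length_reverse, Walk.length_append] at this
      exact_mod_cast (by omega : g ≤ w.length)
    · have := h (q₂.append q₁)
      rw [Walk.length_append] at this
      exact_mod_cast (by omega : g ≤ w.length)
  · have hq : ∀ e ∈ w.edges, e ∈ G.edgeSet := by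
      intro e heq
      have h1 := w.edges_subset_edgeSet heq
      have h2 : e ≠ s(u, v) := fun h' => he (h' ▸ heq)
      induction e with | _ x y =>
      rw [mem_edgeSet, sup_adj, edge_adj] at h1
      rcases h1 with h1 | ⟨h1, -⟩
      · exact h1
      · exact (h2 (by rw [Sym2.eq_iff]; tauto)).elim
    have := hG a (w.transfer G hq) (hw.transfer hq)
    rwa [Walk.length_transfer] at this

open scoped Classical in
theorem card_filter_exists_walk_length_le {V : Type*} [Fintype V] (G : SimpleGraph V) {Δ : ℕ}
    (hΔ : ∀ v, G.degree v ≤ Δ) (k : ℕ) (v : V) :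
    #{w | ∃ q : G.Walk v w, q.length ≤ k} ≤ (Δ + 1) ^ k := by
  induction k generalizing v with
  | zero =>
    rw [pow_zero, Finset.card_le_one]
    intro x hx y hy
    simp only [Finset.mem_filter, Finset.mem_univ, true_and] at hx hy
    obtain ⟨q, hq⟩ := hx
    obtain ⟨q', hq'⟩ := hy
    rw [← Walk.eq_of_length_eq_zero (Nat.le_zero.1 hq),
      ← Walk.eq_of_length_eq_zero (Nat.le_zero.1 hq')]
  | succ k ih =>
    have hsub : (Finset.univ.filter fun w => ∃ q : G.Walk v w, q.length ≤ k + 1) ⊆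
        insert v ((G.neighborFinset v).biUnion
          fun c => Finset.univ.filter fun w => ∃ q : G.Walk c w, q.length ≤ k) := by
      intro w hw
      simp only [Finset.mem_filter, Finset.mem_univ, true_and] at hw
      obtain ⟨q, hq⟩ := hw
      cases q with
      | nil => exact Finset.mem_insert_self _ _
      | @cons _ c _ hc q =>
        refine Finset.mem_insert_of_mem (Finset.mem_biUnion.2 ⟨c, by simpa using hc, ?_⟩)
        simp only [Finset.mem_filter, Finset.mem_univ, true_and]
        exact ⟨q, by simpa using hq⟩
    calc _ ≤ _ := Finset.card_le_card hsub
      _ ≤ Finset.card _ + 1 := Finset.card_insert_le _ _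
      _ ≤ Δ * (Δ + 1) ^ k + 1 := by
        gcongr
        refine (Finset.card_biUnion_le_card_mul _ _ _ fun c _ => ih c).trans ?_
        gcongr
        exact hΔ v
      _ ≤ Δ * (Δ + 1) ^ k + (Δ + 1) ^ k := by gcongr; exact Nat.one_le_pow _ _ (by omega)
      _ = (Δ + 1) ^ (k + 1) := by ring

theorem degree_sup_edge_le {V : Type*} [DecidableEq V] (G : SimpleGraph V) (u v w : V)
    [Fintype (G.neighborSet w)] [Fintype ((G ⊔ edge u v).neighborSet w)] :
    (G ⊔ edge u v).degree w ≤
      G.degree w + ((if w = u then 1 else 0) + (if w = v then 1 else 0)) := by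
  have hsub : (G ⊔ edge u v).neighborFinset w ⊆
      G.neighborFinset w ∪ ((if w = u then {v} else ∅) ∪ (if w = v then {u} else ∅)) := by
    intro x hx
    rw [mem_neighborFinset, sup_adj, edge_adj] at hx
    simp only [Finset.mem_union, mem_neighborFinset]
    rcases hx with hx | ⟨⟨rfl, rfl⟩ | ⟨rfl, rfl⟩, -⟩
    · exact Or.inl hx
    · simp
    · simp
  rw [← card_neighborFinset_eq_degree, ← card_neighborFinset_eq_degree]
  refine (Finset.card_le_card hsub).trans ((Finset.card_union_le _ _).trans ?_)
  refine Nat.add_le_add_left ((Finset.card_union_le _ _).trans ?_) _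
  gcongr <;> split_ifs <;> simp

open scoped Classical in
/-- In a graph of small degree without short cycles, there is an edge of the family `(a ω, b ω)`
that keeps these properties and excludes a fixed fraction of the proper colourings. -/
theorem exists_edge_killing_colorings {V Ω : Type*} [Fintype V] [Fintype Ω] {a b : Ω → V}
    (hab : ∀ ω, a ω ≠ b ω) {K g Δ T W D D₂ : ℕ} (hW : 0 < W)
    (hmono : ∀ c : V → Fin K, W ≤ #{ω | c (a ω) = c (b ω)})
    (hDa : ∀ v, #{ω | a ω = v} ≤ D) (hDb : ∀ v, #{ω | b ω = v} ≤ D)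
    (hD₂ : ∀ u v, u ≠ v → #{ω | a ω = u ∧ b ω = v} ≤ D₂)
    (hball : 4 * (Fintype.card V * ((Δ + 1) ^ g * D₂)) ≤ W)
    (hdeg : 16 * (T * D) ≤ Δ * W) (hΔ : 0 < Δ)
    (G : SimpleGraph V) (hGdeg : ∀ v, G.degree v ≤ Δ) (hGsum : ∑ v, G.degree v ≤ 2 * T)
    (S : Finset (V → Fin K)) (hS : S.Nonempty) :
    ∃ ω, (∀ q : G.Walk (a ω) (b ω), g ≤ q.length) ∧ G.degree (a ω) < Δ ∧ G.degree (b ω) < Δ ∧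
      #S * W ≤ 2 * Fintype.card Ω * #{c ∈ S | c (a ω) = c (b ω)} := by
  set H : Finset V := {v | Δ ≤ G.degree v} with hH
  set B₁ : Finset Ω := {ω | ∃ q : G.Walk (a ω) (b ω), q.length ≤ g} with hB₁
  set B₂ : Finset Ω := {ω | a ω ∈ H} with hB₂
  set B₃ : Finset Ω := {ω | b ω ∈ H} with hB₃
  set B := B₁ ∪ (B₂ ∪ B₃) with hB
  have hHcard : #H * Δ ≤ 2 * T := by
    refine le_trans ?_ hGsum
    calc #H * Δ = ∑ v ∈ H, Δ := by simp
      _ ≤ ∑ v ∈ H, G.degree v := Finset.sum_le_sum fun v hv => by simpa [hH] using hv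
      _ ≤ _ := Finset.sum_le_univ_sum_of_nonneg fun _ => Nat.zero_le _
  have hB₁card : #B₁ ≤ Fintype.card V * ((Δ + 1) ^ g * D₂) := by
    have hsub : B₁ ⊆ Finset.univ.biUnion fun u : V =>
        ({w | ∃ q : G.Walk u w, q.length ≤ g} : Finset V).biUnion fun w =>
          {ω | a ω = u ∧ b ω = w} := by
      intro ω hω
      simp only [hB₁, Finset.mem_filter, Finset.mem_univ, true_and] at hω
      simp only [Finset.mem_biUnion, Finset.mem_filter, Finset.mem_univ, true_and]
      exact ⟨a ω, b ω, hω, rfl, rfl⟩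
    refine (Finset.card_le_card hsub).trans ?_
    refine Finset.card_biUnion_le_card_mul _ _ _ fun u _ => ?_
    refine (Finset.card_biUnion_le_card_mul _ _ D₂ fun w _ => ?_).trans ?_
    · by_cases huw : u = w
      · subst huw
        rw [Finset.card_eq_zero.2]
        · exact Nat.zero_le _
        · rw [Finset.filter_eq_empty_iff]
          rintro ω - ⟨h1, h2⟩
          exact hab ω (h1.trans h2.symm)
      · exact hD₂ u w huw
    · exact Nat.mul_le_mul_right _ (G.card_filter_exists_walk_length_le hGdeg g u)
  have hB₂card : #B₂ ≤ #H * D := by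
    have hsub : B₂ ⊆ H.biUnion fun u : V => ({ω | a ω = u} : Finset Ω) := by
      intro ω hω
      simp only [hB₂, Finset.mem_filter, Finset.mem_univ, true_and] at hω
      simpa using hω
    exact (Finset.card_le_card hsub).trans (Finset.card_biUnion_le_card_mul _ _ _ fun u _ => hDa u)
  have hB₃card : #B₃ ≤ #H * D := by
    have hsub : B₃ ⊆ H.biUnion fun u : V => ({ω | b ω = u} : Finset Ω) := by
      intro ω hω
      simp only [hB₃, Finset.mem_filter, Finset.mem_univ, true_and] at hω
      simpa using hω
    exact (Finset.card_le_card hsub).trans (Finset.card_biUnion_le_card_mul _ _ _ fun u _ => hDb u)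
  have hHD : 8 * (#H * D) ≤ W := by
    refine Nat.le_of_mul_le_mul_left ?_ hΔ
    calc Δ * (8 * (#H * D)) = 8 * ((#H * Δ) * D) := by ring
      _ ≤ 8 * ((2 * T) * D) := by gcongr
      _ = 16 * (T * D) := by ring
      _ ≤ Δ * W := hdeg
  -- Pairs joined by a short walk number at most W/4, pairs with a saturated first or second end at
  -- most W/8 each; so every colouring keeps W/2 monochromatic admissible pairs.
  have hBcard : 2 * #B ≤ W := by
    have h1 := Finset.card_union_le B₁ (B₂ ∪ B₃)
    have h2 := Finset.card_union_le B₂ B₃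
    rw [← hB] at h1
    omega
  have hgood : ∀ c : V → Fin K, W ≤ 2 * #{ω ∈ Bᶜ | c (a ω) = c (b ω)} := by
    intro c
    have h1 : ({ω | c (a ω) = c (b ω)} : Finset Ω) ⊆ B ∪ {ω ∈ Bᶜ | c (a ω) = c (b ω)} := by
      intro ω hω
      simp only [Finset.mem_filter, Finset.mem_univ, true_and] at hω
      by_cases hωB : ω ∈ B
      · exact Finset.mem_union_left _ hωB
      · exact Finset.mem_union_right _ (by simp [hωB, hω])
    have h2 := (Finset.card_le_card h1).trans (Finset.card_union_le _ _)
    have h3 := hmono c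
    omega
  have hcount : #S * W ≤ 2 * ∑ ω ∈ Bᶜ, #{c ∈ S | c (a ω) = c (b ω)} := by
    have := Finset.sum_card_bipartiteAbove_eq_sum_card_bipartiteBelow
      (s := S) (t := Bᶜ) (fun (c : V → Fin K) ω => c (a ω) = c (b ω))
    simp only [Finset.bipartiteAbove, Finset.bipartiteBelow] at this
    rw [← this, Finset.mul_sum, ← smul_eq_mul, ← Finset.sum_const]
    exact Finset.sum_le_sum fun c _ => hgood c
  have hBne : (Bᶜ).Nonempty := by
    obtain ⟨c, -⟩ := hS
    have : 0 < #{ω ∈ Bᶜ | c (a ω) = c (b ω)} := by have := hgood c; omega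
    obtain ⟨ω, hω⟩ := Finset.card_pos.1 this
    exact ⟨ω, (Finset.mem_filter.1 hω).1⟩
  -- Averaging the double count `hcount` over the admissible pairs.
  have hex : ∃ ω ∈ Bᶜ, #S * W ≤ 2 * Fintype.card Ω * #{c ∈ S | c (a ω) = c (b ω)} := by
    by_contra! hcon
    have h1 := Finset.sum_lt_sum_of_nonempty hBne hcon
    rw [← Finset.mul_sum, Finset.sum_const, smul_eq_mul] at h1
    have h2 : #Bᶜ * (#S * W) ≤ Fintype.card Ω * (#S * W) :=
      Nat.mul_le_mul_right _ (Finset.card_le_univ _)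
    have h3 := Nat.mul_le_mul_left (Fintype.card Ω) hcount
    have h4 : 2 * Fintype.card Ω * ∑ ω ∈ Bᶜ, #{c ∈ S | c (a ω) = c (b ω)} =
      Fintype.card Ω * (2 * ∑ ω ∈ Bᶜ, #{c ∈ S | c (a ω) = c (b ω)}) := by ring
    omega
  obtain ⟨ω, hωB, hω⟩ := hex
  simp only [hB, hB₁, hB₂, hB₃, hH, Finset.mem_compl, Finset.mem_union, Finset.mem_filter,
    Finset.mem_univ, true_and, not_or, not_exists, not_le] at hωB
  exact ⟨ω, fun q => (hωB.1 q).le, hωB.2.1, hωB.2.2, hω⟩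

open scoped Classical in
/-- The proper colourings of `G` with `K` colours, as functions. -/
noncomputable def properColorings {V : Type*} [Fintype V] (G : SimpleGraph V) (K : ℕ) :
    Finset (V → Fin K) :=
  {c | ∀ u v, G.Adj u v → c u ≠ c v}

theorem mem_properColorings {V : Type*} [Fintype V] {G : SimpleGraph V} {K : ℕ} {c : V → Fin K} :
    c ∈ G.properColorings K ↔ ∀ u v, G.Adj u v → c u ≠ c v := by
  simp [properColorings]

-- If all admissible graphs of large girth were colourable, a killing edge could be inserted at each
-- of T steps, since proper colourings would always remain. Each insertion multiplies their number
-- by at most 1 - W / (2|Ω|), so by `hT` fewer than one would survive.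
open scoped Classical in
theorem exists_le_egirth_not_colorable {V Ω : Type*} [Fintype V] [Fintype Ω] {a b : Ω → V}
    (hab : ∀ ω, a ω ≠ b ω) {K g Δ T W D D₂ : ℕ} (hW : 0 < W)
    (hmono : ∀ c : V → Fin K, W ≤ #{ω | c (a ω) = c (b ω)})
    (hDa : ∀ v, #{ω | a ω = v} ≤ D) (hDb : ∀ v, #{ω | b ω = v} ≤ D)
    (hD₂ : ∀ u v, u ≠ v → #{ω | a ω = u ∧ b ω = v} ≤ D₂)
    (hball : 4 * (Fintype.card V * ((Δ + 1) ^ g * D₂)) ≤ W)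
    (hdeg : 16 * (T * D) ≤ Δ * W) (hΔ : 0 < Δ)
    (hT : (K : ℝ) ^ Fintype.card V * (1 - (W : ℝ) / (2 * Fintype.card Ω)) ^ T < 1) :
    ∃ G : SimpleGraph V,
      (∀ u v, G.Adj u v → ∃ ω, (u = a ω ∧ v = b ω) ∨ (u = b ω ∧ v = a ω)) ∧
      (g : ℕ∞) ≤ G.egirth ∧ ¬ G.Colorable K := by
  by_contra! hcon
  have hcol : ∀ G : SimpleGraph V,
      (∀ u v, G.Adj u v → ∃ ω, (u = a ω ∧ v = b ω) ∨ (u = b ω ∧ v = a ω)) →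
      (g : ℕ∞) ≤ G.egirth →
      (G.properColorings K).Nonempty := by
    intro G h1 h2
    obtain ⟨C⟩ := hcon G h1 h2
    exact ⟨C, mem_properColorings.2 fun u v h => C.valid h⟩
  have key : ∀ t ≤ T, ∃ G : SimpleGraph V,
      (∀ u v, G.Adj u v → ∃ ω, (u = a ω ∧ v = b ω) ∨ (u = b ω ∧ v = a ω)) ∧
      (g : ℕ∞) ≤ G.egirth ∧ (∀ v, G.degree v ≤ Δ) ∧ ∑ v, G.degree v ≤ 2 * t ∧
      (#(G.properColorings K) : ℝ) ≤
        (K : ℝ) ^ Fintype.card V * (1 - (W : ℝ) / (2 * Fintype.card Ω)) ^ t := by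
    intro t
    induction t with
    | zero =>
      intro _
      refine ⟨⊥, by simp, by simp, by simp, by simp, ?_⟩
      have := Finset.card_le_univ (properColorings (⊥ : SimpleGraph V) K)
      rw [Fintype.card_fun, Fintype.card_fin] at this
      rw [pow_zero, mul_one]
      exact_mod_cast this
    | succ t ih =>
      intro ht
      obtain ⟨G, hG, hgirth, hGdeg, hGsum, hcard⟩ := ih (by omega)
      obtain ⟨ω, hwalk, hda, hdb, hω⟩ := exists_edge_killing_colorings hab hW hmono hDa hDb hD₂
        hball hdeg hΔ G hGdeg (hGsum.trans (by omega)) _ (hcol G hG hgirth)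
      obtain ⟨G', hG'⟩ : ∃ G', G' = G ⊔ edge (a ω) (b ω) := ⟨_, rfl⟩
      have hdeg' : ∀ v, G'.degree v ≤
          G.degree v + ((if v = a ω then 1 else 0) + (if v = b ω then 1 else 0)) := by
        intro v
        subst hG'
        convert G.degree_sup_edge_le (a ω) (b ω) v
      refine ⟨G', ?_, hG' ▸ le_egirth_sup_edge hgirth hwalk, ?_, ?_, ?_⟩
      · intro u v huv
        rw [hG', sup_adj, edge_adj] at huv
        rcases huv with huv | ⟨huv, -⟩
        · exact hG u v huv
        · exact ⟨ω, by tauto⟩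
      · intro v
        refine (hdeg' v).trans ?_
        have := hGdeg v
        have := hab ω
        split_ifs with h1 h2 h2
        · exact (this (h1.symm.trans h2)).elim
        · subst h1; omega
        · subst h2; omega
        · omega
      · refine (Finset.sum_le_sum fun v _ => hdeg' v).trans ?_
        rw [Finset.sum_add_distrib, Finset.sum_add_distrib]
        simp only [Finset.sum_ite_eq', Finset.mem_univ, if_true]
        omega
      · subst hG'
        set S : Finset (V → Fin K) := G.properColorings K with hS
        have hsub : (G ⊔ edge (a ω) (b ω)).properColorings K ⊆ S.filter fun c => ¬ c (a ω) = c (b ω) := by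
          intro c hc
          rw [mem_properColorings] at hc
          rw [Finset.mem_filter, hS, mem_properColorings]
          refine ⟨fun u v huv => hc u v (Or.inl huv), hc _ _ (Or.inr ?_)⟩
          rw [edge_adj]
          exact ⟨Or.inl ⟨rfl, rfl⟩, hab ω⟩
        have h1 := Finset.card_le_card hsub
        have h2 := Finset.card_filter_add_card_filter_not (s := S) (fun c => c (a ω) = c (b ω))
        have hΩ : (0 : ℝ) < Fintype.card Ω := by
          exact_mod_cast Fintype.card_pos_iff.2 ⟨ω⟩
        have hWΩ : (W : ℝ) ≤ Fintype.card Ω := by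
          obtain ⟨c, -⟩ := hcol G hG hgirth
          exact_mod_cast (hmono c).trans (Finset.card_le_univ _)
        have h3 : (#S : ℝ) * W ≤
            2 * Fintype.card Ω * #(S.filter fun c => c (a ω) = c (b ω)) := by
          exact_mod_cast hω
        have h4 : (#S : ℝ) * (W / (2 * Fintype.card Ω)) ≤
            #(S.filter fun c => c (a ω) = c (b ω)) := by
          rw [← mul_div_assoc, div_le_iff₀ (by positivity)]
          linarith
        have h5 : (#(S.filter fun c => c (a ω) = c (b ω)) : ℝ) +
            #(S.filter fun c => ¬ c (a ω) = c (b ω)) = #S := by exact_mod_cast h2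
        have h6 : (#((G ⊔ edge (a ω) (b ω)).properColorings K) : ℝ) ≤ #(S.filter fun c => ¬ c (a ω) = c (b ω)) := by
          exact_mod_cast h1
        have h7 : (W : ℝ) / (2 * Fintype.card Ω) ≤ 1 := by
          rw [div_le_one (by positivity)]
          linarith
        calc _ ≤ _ := h6
          _ ≤ (#S : ℝ) * (1 - W / (2 * Fintype.card Ω)) := by linarith
          _ ≤ ((K : ℝ) ^ Fintype.card V * (1 - (W : ℝ) / (2 * Fintype.card Ω)) ^ t) *
              (1 - W / (2 * Fintype.card Ω)) := by
            gcongr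
          _ = _ := by ring
  obtain ⟨G, hG, hgirth, -, -, hcard⟩ := key T le_rfl
  have h1 : (1 : ℝ) ≤ #(G.properColorings K) := by
    exact_mod_cast Finset.card_pos.2 (hcol G hG hgirth)
  linarith

end SimpleGraph

/-! ### Sparse lifts of a graph to labelled supports. -/

namespace SimpleGraph

/-- The restriction of `θ` to the set `σ x`, as a point of the fibred vertex set. -/
def restrictPoint {X J : Type*} (σ : X → Finset J) {r : ℕ} (x : X) (θ : J → Fin r) :
    Σ x, (σ x → Fin r) :=
  ⟨x, fun j => θ j⟩

theorem restrictPoint_eq_iff {X J : Type*} {σ : X → Finset J} {r : ℕ} {x y : X}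
    {θ θ' : J → Fin r} (h : restrictPoint σ x θ = restrictPoint σ y θ') :
    x = y ∧ ∀ j ∈ σ x, θ j = θ' j := by
  rw [restrictPoint, restrictPoint, Sigma.mk.inj_iff] at h
  obtain ⟨rfl, h⟩ := h
  exact ⟨rfl, fun j hj => congr_fun (eq_of_heq h) ⟨j, hj⟩⟩

theorem card_filter_eqOn_le {J : Type*} [Fintype J] [DecidableEq J] {r : ℕ} (A : Finset J)
    (τ : J → Fin r) :
    #{θ : J → Fin r | ∀ j ∈ A, θ j = τ j} ≤ r ^ (Fintype.card J - #A) := by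
  have hsub : ({θ : J → Fin r | ∀ j ∈ A, θ j = τ j} : Finset (J → Fin r)) ⊆
      Fintype.piFinset fun j => if j ∈ A then {τ j} else univ := by
    intro θ hθ
    simp only [Finset.mem_filter, Finset.mem_univ, true_and] at hθ
    rw [Fintype.mem_piFinset]
    intro j
    split_ifs with h
    · simpa using hθ j h
    · simp
  refine (Finset.card_le_card hsub).trans ?_
  rw [Fintype.card_piFinset, ← Finset.card_compl]
  have : ∀ j, #(if j ∈ A then {τ j} else (univ : Finset (Fin r))) =
      if j ∈ Aᶜ then r else 1 := by
    intro j
    by_cases h : j ∈ A <;> simp [h]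
  rw [Finset.prod_congr rfl fun j _ => this j, Finset.prod_ite_mem, Finset.univ_inter,
    Finset.prod_const]

theorem card_filter_snd_le {Y J : Type*} [Fintype Y] [Fintype J] [DecidableEq J] {r : ℕ}
    (A : Finset J) (P : Finset (Y × (J → Fin r)))
    (hP : ∀ ω ∈ P, ∀ ω' ∈ P, ∀ j ∈ A, ω.2 j = ω'.2 j) :
    #P ≤ Fintype.card Y * r ^ (Fintype.card J - #A) := by
  rcases P.eq_empty_or_nonempty with rfl | ⟨ω₀, hω₀⟩
  · simp
  · have hsub : P ⊆ (univ : Finset Y) ×ˢ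
        ({θ : J → Fin r | ∀ j ∈ A, θ j = ω₀.2 j} : Finset (J → Fin r)) := by
      intro ω hω
      simpa using hP ω hω ω₀ hω₀
    refine (Finset.card_le_card hsub).trans ?_
    rw [Finset.card_product, Finset.card_univ]
    exact Nat.mul_le_mul_left _ (card_filter_eqOn_le A ω₀.2)

/-- If adjacent vertices of a finite graph `F` carry distinct sets of the same size, then `F` has
high-girth non-`K`-colourable lifts to the bundle of `r`-labellings of these sets. -/
theorem exists_sparse_lift {X J : Type*} [Finite X] [Finite J] (F : SimpleGraph X)
    (σ : X → Finset J) {s : ℕ} (hσ : ∀ x, #(σ x) = s) (hF : ∀ x y, F.Adj x y → σ x ≠ σ y)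
    {K : ℕ} (hK : 0 < K) (hcol : ¬ F.Colorable K) (g : ℕ) :
    ∃ (r : ℕ) (G : SimpleGraph (Σ x, (σ x → Fin r))),
      (∀ u v, G.Adj u v → ∃ (x y : X) (θ : J → Fin r), F.Adj x y ∧
        u = restrictPoint σ x θ ∧ v = restrictPoint σ y θ) ∧
      (g : ℕ∞) ≤ G.egirth ∧ ¬ G.Colorable K := by
  classical
  have := Fintype.ofFinite X
  have := Fintype.ofFinite J
  obtain ⟨x₀, y₀, h₀⟩ : ∃ x y, F.Adj x y := by
    by_contra! h
    exact hcol ⟨Coloring.mk (fun _ => ⟨0, hK⟩) fun {x y} hxy => (h x y hxy).elim⟩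
  have hs : ∀ x y, F.Adj x y → s + 1 ≤ #(σ x ∪ σ y) := by
    intro x y hxy
    have h1 : σ x ⊂ σ x ∪ σ y := by
      refine Finset.ssubset_iff_subset_ne.2 ⟨Finset.subset_union_left, fun h => hF x y hxy ?_⟩
      have : σ y ⊆ σ x := by rw [h]; exact Finset.subset_union_right
      exact (Finset.eq_of_subset_of_card_le this (by rw [hσ, hσ])).symm
    have := Finset.card_lt_card h1
    rw [hσ] at this
    exact this
  set n := Fintype.card J with hn
  have hsn : s + 1 ≤ n := (hs x₀ y₀ h₀).trans (Finset.card_le_univ _)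
  set e := Fintype.card F.Dart with he
  have he0 : 0 < e := Fintype.card_pos_iff.2 ⟨⟨(x₀, y₀), h₀⟩⟩
  have hX : 0 < Fintype.card X := Fintype.card_pos_iff.2 ⟨x₀⟩
  have heR : (1 : ℝ) ≤ e := by exact_mod_cast he0
  -- Each insertion will remove a fraction 1/(2e) of the colourings; C insertions per vertex
  -- outweigh the K choices of its colour.
  obtain ⟨C, hC⟩ : ∃ C : ℕ, (1 - 1 / (2 * (e : ℝ))) ^ C < 1 / K := by
    refine exists_pow_lt_of_lt_one (by positivity) ?_
    have : 0 < 1 / (2 * (e : ℝ)) := by positivity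
    linarith
  have hq0 : 0 ≤ 1 - 1 / (2 * (e : ℝ)) := by
    rw [sub_nonneg, div_le_one (by positivity)]
    linarith
  -- `Δ` bounds the degrees for C|V| insertions and is independent of `r`. Then `r` is chosen so
  -- that the short-walk condition becomes an equality: pairs have r times fewer common labellings
  -- than single vertices.
  set Δ := 16 * C * Fintype.card X * e + 1 with hΔ
  set r := 4 * Fintype.card X * (Δ + 1) ^ g * e with hr
  have hr0 : 0 < r := by positivity
  have hV : Fintype.card (Σ x, (σ x → Fin r)) = Fintype.card X * r ^ s := by
    rw [Fintype.card_sigma]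
    simp [hσ]
  have hΩ : Fintype.card (F.Dart × (J → Fin r)) = e * r ^ n := by
    simp [he, hn]
  let a : F.Dart × (J → Fin r) → Σ x, (σ x → Fin r) := fun ω => restrictPoint σ ω.1.fst ω.2
  let b : F.Dart × (J → Fin r) → Σ x, (σ x → Fin r) := fun ω => restrictPoint σ ω.1.snd ω.2
  obtain ⟨G, hG, hg, hGc⟩ := exists_le_egirth_not_colorable (a := a) (b := b) (K := K) (g := g)
    (Δ := Δ) (T := C * (Fintype.card X * r ^ s)) (W := r ^ n) (D := e * r ^ (n - s))
    (D₂ := e * r ^ (n - (s + 1))) (fun ω h => ω.1.adj.ne (restrictPoint_eq_iff h).1) (by positivity)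
    (by
      intro c
      -- For fixed θ the restricted points form a copy of `F`, which is not K-colourable, so each θ
      -- contributes a monochromatic pair.
      have hex : ∀ θ : J → Fin r, ∃ d : F.Dart, c (a (d, θ)) = c (b (d, θ)) := by
        intro θ
        by_contra! h
        exact hcol ⟨Coloring.mk (fun x => c (restrictPoint σ x θ)) fun {x y} hxy =>
          h ⟨(x, y), hxy⟩⟩
      choose d hd using hex
      calc r ^ n = #(univ : Finset (J → Fin r)) := by simp [hn]
        _ ≤ _ := Finset.card_le_card_of_injOn (fun θ => (d θ, θ))
          (fun θ _ => by simpa using hd θ) (fun θ _ θ' _ h => (Prod.ext_iff.1 h).2))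
    (by
      intro v
      rw [← hσ v.1]
      refine card_filter_snd_le _ _ fun ω hω ω' hω' j hj => ?_
      simp only [Finset.mem_filter, Finset.mem_univ, true_and] at hω hω'
      refine (restrictPoint_eq_iff (hω.trans hω'.symm)).2 j ?_
      rw [← hω] at hj
      exact hj)
    (by
      intro v
      rw [← hσ v.1]
      refine card_filter_snd_le _ _ fun ω hω ω' hω' j hj => ?_
      simp only [Finset.mem_filter, Finset.mem_univ, true_and] at hω hω'
      refine (restrictPoint_eq_iff (hω.trans hω'.symm)).2 j ?_
      rw [← hω] at hj
      exact hj)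
    (by
      -- Both endpoints together determine θ on the union of two distinct s-sets, hence on at least
      -- s + 1 indices.
      intro u v _
      by_cases huv : F.Adj u.1 v.1
      · refine (card_filter_snd_le (σ u.1 ∪ σ v.1) _ fun ω hω ω' hω' j hj => ?_).trans ?_
        · simp only [Finset.mem_filter, Finset.mem_univ, true_and] at hω hω'
          rcases Finset.mem_union.1 hj with hj | hj
          · refine (restrictPoint_eq_iff (hω.1.trans hω'.1.symm)).2 j ?_
            rw [← hω.1] at hj
            exact hj
          · refine (restrictPoint_eq_iff (hω.2.trans hω'.2.symm)).2 j ?_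
            rw [← hω.2] at hj
            exact hj
        · exact Nat.mul_le_mul_left _ (Nat.pow_le_pow_right hr0
            (Nat.sub_le_sub_left (hs _ _ huv) _))
      · rw [Finset.card_eq_zero.2]
        · exact Nat.zero_le _
        · refine Finset.eq_empty_of_forall_notMem fun ω hω => ?_
          simp only [Finset.mem_filter, Finset.mem_univ, true_and] at hω
          obtain ⟨rfl, rfl⟩ := hω
          exact huv ω.1.adj)
    (by
      rw [hV]
      have : r ^ n = r * (r ^ s * r ^ (n - (s + 1))) := by
        rw [← pow_add, ← pow_succ']
        congr 1
        omega
      rw [this]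
      nth_rw 3 [hr]
      exact le_of_eq (by ring))
    (by
      have : r ^ n = r ^ s * r ^ (n - s) := by
        rw [← pow_add]
        congr 1
        omega
      rw [this, hΔ]
      calc _ = (16 * C * Fintype.card X * e) * (r ^ s * r ^ (n - s)) := by ring
        _ ≤ _ := Nat.mul_le_mul_right _ (Nat.le_succ _))
    (by positivity)
    (by
      have h1 : ((r ^ n : ℕ) : ℝ) / (2 * (Fintype.card (F.Dart × (J → Fin r)) : ℕ)) =
          1 / (2 * e) := by
        rw [hΩ]
        have : (r : ℝ) ≠ 0 := by positivity
        push_cast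
        field_simp
      rw [h1, hV, pow_mul _ C, ← mul_pow]
      refine pow_lt_one₀ (by positivity) ?_ (by positivity)
      rw [lt_div_iff₀ (by positivity)] at hC
      linarith)
  refine ⟨r, G, fun u v huv => ?_, hg, hGc⟩
  obtain ⟨ω, ⟨rfl, rfl⟩ | ⟨rfl, rfl⟩⟩ := hG u v huv
  · exact ⟨_, _, ω.2, ω.1.adj, rfl, rfl⟩
  · exact ⟨_, _, ω.2, ω.1.adj.symm, rfl, rfl⟩

end SimpleGraph

/-! ### The sign-vector graph and the polynomial method. -/

/-- Vectors with entries in `{-1, 0, 1}` and exactly `s` nonzero entries. -/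
def signVectors (n s : ℕ) : Finset (Fin n → ℤ) :=
  {x ∈ Fintype.piFinset fun _ => ({-1, 0, 1} : Finset ℤ) | #{j | x j ≠ 0} = s}

theorem mem_signVectors {n s : ℕ} {x : Fin n → ℤ} :
    x ∈ signVectors n s ↔ (∀ j, x j = -1 ∨ x j = 0 ∨ x j = 1) ∧ #{j | x j ≠ 0} = s := by
  simp [signVectors]

theorem sum_sq_of_mem_signVectors {n s : ℕ} {x : Fin n → ℤ} (hx : x ∈ signVectors n s) :
    ∑ j, x j ^ 2 = s := by
  rw [mem_signVectors] at hx
  rw [← hx.2, Finset.card_filter]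
  push_cast
  refine Finset.sum_congr rfl fun j _ => ?_
  rcases hx.1 j with h | h | h <;> simp [h]

theorem choose_mul_two_pow_le_card_signVectors (n s : ℕ) :
    n.choose s * 2 ^ s ≤ #(signVectors n s) := by
  have hcard : #((powersetCard s (univ : Finset (Fin n))).sigma fun S => S.powerset) =
      n.choose s * 2 ^ s := by
    rw [Finset.card_sigma, Finset.sum_congr rfl (g := fun _ => 2 ^ s), Finset.sum_const,
      Finset.card_powersetCard, Finset.card_univ, Fintype.card_fin, smul_eq_mul]
    intro S hS
    rw [Finset.card_powerset, (Finset.mem_powersetCard.1 hS).2]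
  rw [← hcard]
  refine Finset.card_le_card_of_injOn
    (fun S j => if j ∈ S.2 then -1 else if j ∈ S.1 then 1 else 0) ?_ ?_
  · rintro ⟨S, T⟩ h
    simp only [Finset.coe_sigma, Set.mem_sigma_iff, Finset.mem_coe, Finset.mem_powersetCard,
      Finset.mem_powerset] at h
    rw [Finset.mem_coe, mem_signVectors]
    refine ⟨fun j => ?_, ?_⟩
    · dsimp only
      split_ifs <;> simp
    · rw [← h.1.2]
      congr 1
      ext j
      have := @h.2 j
      simp only [Finset.mem_filter, Finset.mem_univ, true_and]
      split_ifs with h1 h2 <;> simp_all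
  · rintro ⟨S, T⟩ h ⟨S', T'⟩ h' heq
    simp only [Finset.coe_sigma, Set.mem_sigma_iff, Finset.mem_coe, Finset.mem_powersetCard,
      Finset.mem_powerset] at h h'
    have hT : T = T' := by
      ext j
      have := congr_fun heq j
      dsimp only at this
      split_ifs at this <;> simp_all
    have hS : S = S' := by
      ext j
      have := congr_fun heq j
      have h1 := @h.2 j
      have h2 := @h'.2 j
      dsimp only at this
      split_ifs at this <;> simp_all
    subst hT hS
    rfl

/-- The exponent vectors in `{0, 1, 2}ⁿ` of total degree at most `k`. -/
def lowExponents (n k : ℕ) : Finset (Fin n → Fin 3) :=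
  {e | ∑ j, (e j : ℕ) ≤ k}

/-- Chernoff-type bound: weight each exponent vector by t to its degree; the total weight factors
over the coordinates. -/
theorem card_lowExponents_mul_pow_le (n k : ℕ) {t : ℝ} (ht0 : 0 < t) (ht1 : t ≤ 1) :
    #(lowExponents n k) * t ^ k ≤ (1 + t + t ^ 2) ^ n := by
  have h : ∑ e : Fin n → Fin 3, t ^ (∑ j, (e j : ℕ)) = (1 + t + t ^ 2) ^ n := by
    have h1 := Finset.prod_univ_sum (fun _ : Fin n => (univ : Finset (Fin 3)))
      (fun _ i => t ^ (i : ℕ))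
    rw [Fintype.piFinset_univ] at h1
    simp_rw [← Finset.prod_pow_eq_pow_sum]
    rw [← h1]
    simp [Fin.sum_univ_three]
  rw [← h, ← nsmul_eq_mul, ← Finset.sum_const]
  calc _ ≤ ∑ e ∈ lowExponents n k, t ^ (∑ j, (e j : ℕ)) :=
        Finset.sum_le_sum fun e he =>
          pow_le_pow_of_le_one ht0.le ht1 (by simpa [lowExponents] using he)
    _ ≤ _ := Finset.sum_le_univ_sum_of_nonneg fun _ => by positivity

/-- The span of the monomial functions of low degree on a set of vectors. -/
def lowSpan (p : ℕ) {n : ℕ} (X : Finset (Fin n → ℤ)) (k : ℕ) : Submodule (ZMod p) (X → ZMod p) :=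
  Submodule.span (ZMod p) (Set.range fun (e : lowExponents n k) (x : X) =>
    ∏ j, ((x.1 j : ℤ) : ZMod p) ^ ((e.1 j : Fin 3) : ℕ))

theorem lowSpan_mono (p : ℕ) {n : ℕ} (X : Finset (Fin n → ℤ)) {k l : ℕ} (h : k ≤ l) :
    lowSpan p X k ≤ lowSpan p X l := by
  refine Submodule.span_mono ?_
  rintro _ ⟨e, rfl⟩
  have := e.2
  simp only [lowExponents, Finset.mem_filter, Finset.mem_univ, true_and] at this
  exact ⟨⟨e.1, by simpa [lowExponents] using this.trans h⟩, rfl⟩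

theorem coord_mul_mem_lowSpan (p : ℕ) {n s : ℕ} {k : ℕ} (i : Fin n)
    {f : signVectors n s → ZMod p} (hf : f ∈ lowSpan p (signVectors n s) k) :
    (fun x => ((x.1 i : ℤ) : ZMod p) * f x) ∈ lowSpan p (signVectors n s) (k + 1) := by
  induction hf using Submodule.span_induction with
  | zero =>
    have : (fun x : signVectors n s => ((x.1 i : ℤ) : ZMod p) * (0 : signVectors n s → ZMod p) x) =
      0 := by ext; simp
    rw [this]
    exact zero_mem _
  | add f g _ _ hf hg =>
    convert add_mem hf hg using 1
    ext
    simp [mul_add]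
  | smul c f _ hf =>
    convert Submodule.smul_mem _ c hf using 1
    ext
    simp [mul_left_comm]
  | mem f hf =>
    obtain ⟨⟨e, he⟩, rfl⟩ := hf
    simp only [lowExponents, Finset.mem_filter, Finset.mem_univ, true_and] at he
    -- On {-1, 0, 1} the identity z³ = z brings an exponent 3 back to 1, so exponents stay in `Fin
    -- 3`.
    have key : ∀ d : Fin 3, (∀ z : ℤ, z = -1 ∨ z = 0 ∨ z = 1 →
        (z : ZMod p) * (z : ZMod p) ^ ((e i : Fin 3) : ℕ) = (z : ZMod p) ^ (d : ℕ)) →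
        (d : ℕ) ≤ (e i : ℕ) + 1 →
        (fun x : signVectors n s => ((x.1 i : ℤ) : ZMod p) *
          ∏ j, ((x.1 j : ℤ) : ZMod p) ^ ((e j : Fin 3) : ℕ)) ∈
          lowSpan p (signVectors n s) (k + 1) := by
      intro d hd hdeg
      refine Submodule.subset_span ⟨⟨Function.update e i d, ?_⟩, ?_⟩
      · simp only [lowExponents, Finset.mem_filter, Finset.mem_univ, true_and]
        rw [← Finset.add_sum_erase _ _ (Finset.mem_univ i)] at he ⊢
        rw [Function.update_self, Finset.sum_congr rfl (g := fun j => (e j : ℕ))]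
        · omega
        · intro j hj
          rw [Function.update_of_ne (Finset.ne_of_mem_erase hj)]
      · ext x
        dsimp only
        rw [← Finset.mul_prod_erase _ _ (Finset.mem_univ i),
          ← Finset.mul_prod_erase _ _ (Finset.mem_univ i), ← mul_assoc,
          hd _ ((mem_signVectors.1 x.2).1 i), Function.update_self]
        congr 1
        refine Finset.prod_congr rfl fun j hj => ?_
        rw [Function.update_of_ne (Finset.ne_of_mem_erase hj)]
    generalize hei : e i = ei at key
    fin_cases ei
    · exact key 1 (fun z _ => by simp) (by simp)
    · exact key 2 (fun z _ => by simp [pow_two]) (by simp)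
    · refine key 1 (fun z hz => ?_) (by simp)
      rcases hz with rfl | rfl | rfl <;> simp

theorem affine_pow_mem_lowSpan (p : ℕ) {n s : ℕ} (y : Fin n → ℤ) (k : ℕ) :
    (fun x : signVectors n s => (((1 + ∑ j, x.1 j * y j : ℤ)) : ZMod p) ^ k) ∈
      lowSpan p (signVectors n s) k := by
  induction k with
  | zero =>
    refine Submodule.subset_span ⟨⟨0, by simp [lowExponents]⟩, ?_⟩
    ext x
    simp
  | succ k ih =>
    have : (fun x : signVectors n s => (((1 + ∑ j, x.1 j * y j : ℤ)) : ZMod p) ^ (k + 1)) =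
        (fun x : signVectors n s => (((1 + ∑ j, x.1 j * y j : ℤ)) : ZMod p) ^ k) +
        ∑ j, ((y j : ℤ) : ZMod p) • fun x : signVectors n s => ((x.1 j : ℤ) : ZMod p) *
          (((1 + ∑ j, x.1 j * y j : ℤ)) : ZMod p) ^ k := by
      ext x
      rw [Pi.add_apply, Finset.sum_apply, pow_succ']
      simp only [Pi.smul_apply, smul_eq_mul]
      rw [Finset.sum_congr rfl (g := fun j => ((x.1 j : ZMod p) * (y j : ZMod p)) *
        (((1 + ∑ j, x.1 j * y j : ℤ)) : ZMod p) ^ k) (fun j _ => by ring), ← Finset.sum_mul]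
      push_cast
      ring
    rw [this]
    exact add_mem (lowSpan_mono p _ (Nat.le_succ k) ih)
      (sum_mem fun j _ => Submodule.smul_mem _ _ (coord_mul_mem_lowSpan p j ih))

/-- Both bounds come from expanding the squared norms of x + y and x - y. For s = p - 1 they leave 0
as the only multiple of p that 1 + ⟨x, y⟩ can equal. -/
theorem sum_mul_cases {n s : ℕ} {x y : Fin n → ℤ} (hx : x ∈ signVectors n s)
    (hy : y ∈ signVectors n s) (hne : x ≠ y) :
    -(s : ℤ) ≤ ∑ j, x j * y j ∧ ∑ j, x j * y j < s := by
  have hx2 := sum_sq_of_mem_signVectors hx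
  have hy2 := sum_sq_of_mem_signVectors hy
  have h1 : ∑ j, (x j + y j) ^ 2 = 2 * s + 2 * ∑ j, x j * y j := by
    simp_rw [add_sq, Finset.sum_add_distrib, mul_assoc, ← Finset.mul_sum]
    linarith
  have h2 : ∑ j, (x j - y j) ^ 2 = 2 * s - 2 * ∑ j, x j * y j := by
    simp_rw [sub_sq, Finset.sum_add_distrib, Finset.sum_sub_distrib, mul_assoc, ← Finset.mul_sum]
    linarith
  have h3 : 0 ≤ ∑ j, (x j + y j) ^ 2 := Finset.sum_nonneg fun j _ => sq_nonneg _
  have h4 : 0 < ∑ j, (x j - y j) ^ 2 := by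
    obtain ⟨j, hj⟩ := Function.ne_iff.1 hne
    exact Finset.sum_pos' (fun j _ => sq_nonneg _)
      ⟨j, Finset.mem_univ _, by have := sub_ne_zero.2 hj; positivity⟩
  constructor <;> linarith

/-- A family of sign vectors without two vectors of inner product `-1` is small. -/
theorem card_le_of_sum_mul_ne_neg_one {n p : ℕ} (hp : p.Prime) (hp2 : 3 ≤ p)
    (I : Finset (Fin n → ℤ)) (hI : I ⊆ signVectors n (p - 1))
    (hind : ∀ x ∈ I, ∀ y ∈ I, ∑ j, x j * y j ≠ -1) :
    #I ≤ #(lowExponents n (p - 1)) := by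
  classical
  have : Fact p.Prime := ⟨hp⟩
  set X := signVectors n (p - 1) with hX
  -- By Fermat, `f y` is the indicator of 1 + ⟨x, y⟩ ≡ 0 mod p. Since ⟨y, y⟩ = p - 1, it equals 1 at
  -- y and vanishes on the rest of `I`, so these functions are independent.
  let f : I → X → ZMod p := fun y x => 1 - (((1 + ∑ j, x.1 j * y.1 j : ℤ)) : ZMod p) ^ (p - 1)
  have hf_mem : ∀ y, f y ∈ lowSpan p X (p - 1) := by
    intro y
    have h0 : (fun _ : X => (1 : ZMod p)) ∈ lowSpan p X (p - 1) := by
      have := affine_pow_mem_lowSpan p (s := p - 1) y.1 0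
      simp only [pow_zero] at this
      exact lowSpan_mono p X (Nat.zero_le _) this
    exact sub_mem h0 (affine_pow_mem_lowSpan p y.1 (p - 1))
  have hdelta : ∀ x y : I, f y ⟨x.1, hI x.2⟩ = if x = y then 1 else 0 := by
    intro x y
    simp only [f]
    have hcast : ((p - 1 : ℕ) : ℤ) = p - 1 := by
      have := hp.one_lt
      omega
    split_ifs with hxy
    · subst hxy
      have h1 := sum_sq_of_mem_signVectors (hI x.2)
      simp_rw [← pow_two]
      rw [h1, hcast]
      have : p - 1 ≠ 0 := by omega
      simp [this]
    · have h1 := sum_mul_cases (hI x.2) (hI y.2) (fun h => hxy (Subtype.ext h))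
      have h2 := hind x.1 x.2 y.1 y.2
      rw [hcast] at h1
      have h3 : ((1 + ∑ j, x.1 j * y.1 j : ℤ) : ZMod p) ≠ 0 := by
        rw [Ne, ZMod.intCast_zmod_eq_zero_iff_dvd]
        intro hdvd
        refine h2 ?_
        have := Int.eq_zero_of_abs_lt_dvd hdvd (by rw [abs_lt]; constructor <;> linarith)
        linarith
      rw [ZMod.pow_card_sub_one_eq_one h3, sub_self]
  have hli : LinearIndependent (ZMod p) f := by
    rw [Fintype.linearIndependent_iff]
    intro c hc x
    have := congr_fun hc ⟨x.1, hI x.2⟩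
    rw [Finset.sum_apply] at this
    simpa [hdelta] using this
  have hli' : LinearIndependent (ZMod p) (fun y => (⟨f y, hf_mem y⟩ : lowSpan p X (p - 1))) :=
    LinearIndependent.of_comp (lowSpan p X (p - 1)).subtype hli
  have h1 := hli'.fintype_card_le_finrank
  have h2 := finrank_range_le_card (R := ZMod p)
    (fun (e : lowExponents n (p - 1)) (x : X) =>
      ∏ j, ((x.1 j : ℤ) : ZMod p) ^ ((e.1 j : Fin 3) : ℕ))
  rw [Fintype.card_coe] at h1 h2
  exact h1.trans h2

/-- The graph on sign vectors in which adjacency means inner product `-1`. -/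
def signGraph (n s : ℕ) : SimpleGraph (signVectors n s) where
  Adj x y := ∑ j, x.1 j * y.1 j = -1
  symm := ⟨fun x y h => by simpa only [mul_comm] using h⟩
  loopless := ⟨fun x h => by
    simp_rw [← pow_two] at h
    have : 0 ≤ ∑ j, x.1 j ^ 2 := Finset.sum_nonneg fun j _ => sq_nonneg _
    linarith⟩

theorem choose_mul_two_pow_le_of_colorable_signGraph {n p K : ℕ} (hp : p.Prime) (hp2 : 3 ≤ p)
    (h : (signGraph n (p - 1)).Colorable K) :
    n.choose (p - 1) * 2 ^ (p - 1) ≤ K * #(lowExponents n (p - 1)) := by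
  classical
  obtain ⟨C⟩ := h
  refine (choose_mul_two_pow_le_card_signVectors n (p - 1)).trans ?_
  rw [← Fintype.card_coe, ← Finset.card_univ,
    Finset.card_eq_sum_card_fiberwise (f := C) (t := univ) (fun _ _ => Finset.mem_univ _)]
  refine (Finset.sum_le_card_nsmul _ _ (#(lowExponents n (p - 1))) fun i _ => ?_).trans
    (by simp)
  rw [← Finset.card_map ⟨Subtype.val, Subtype.val_injective⟩]
  refine card_le_of_sum_mul_ne_neg_one hp hp2 _ ?_ ?_
  · intro x hx
    obtain ⟨y, -, rfl⟩ := Finset.mem_map.1 hx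
    exact y.2
  · intro x hx y hy hxy
    obtain ⟨x, hx', rfl⟩ := Finset.mem_map.1 hx
    obtain ⟨y, hy', rfl⟩ := Finset.mem_map.1 hy
    rw [Finset.mem_filter] at hx' hy'
    exact C.valid (v := x) (w := y) hxy (hx'.2.trans hy'.2.symm)

/-- The support of a sign vector. -/
def signSupport {n s : ℕ} (x : signVectors n s) : Finset (Fin n) :=
  {j | x.1 j ≠ 0}

theorem card_signSupport {n s : ℕ} (x : signVectors n s) : #(signSupport x) = s :=
  (mem_signVectors.1 x.2).2

/-- Vectors with equal supports satisfy ⟨x, y⟩ ≡ s mod 2, which is even, whereas -1 is odd. -/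
theorem signSupport_ne_of_adj {n s : ℕ} (hs : Even s) (x y : signVectors n s)
    (h : (signGraph n s).Adj x y) : signSupport x ≠ signSupport y := by
  intro hxy
  have h1 : ∑ j, x.1 j * y.1 j = -1 := h
  have h2 := sum_sq_of_mem_signVectors x.2
  have h3 : Even (∑ j, (x.1 j ^ 2 - x.1 j * y.1 j)) := by
    refine Finset.even_sum _ fun j _ => ?_
    have hj : x.1 j ≠ 0 ↔ y.1 j ≠ 0 := by
      have := Finset.ext_iff.1 hxy j
      simpa [signSupport] using this
    rcases (mem_signVectors.1 x.2).1 j with h | h | h <;>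
      rcases (mem_signVectors.1 y.2).1 j with h' | h' | h' <;>
      simp [h, h'] at hj ⊢
  rw [Finset.sum_sub_distrib, h1, h2] at h3
  obtain ⟨a, ha⟩ := hs
  obtain ⟨b, hb⟩ := h3
  omega

/-! ### Realization by rank-one Hermitian matrices. -/

open scoped ComplexConjugate in
/-- The coordinates of the Hermitian matrix `z zᴴ` in a real orthonormal basis, padded by zeros. -/
noncomputable def hermitianPoint {ι : Type*} {d : ℕ} (e : ι × ι → Fin d) (z : ι → ℂ) :
    EuclideanSpace ℝ (Fin d) :=
  WithLp.toLp 2 (Function.extend e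
    (fun q => (z q.1 * conj (z q.2)).re + (z q.1 * conj (z q.2)).im) 0)

open scoped ComplexConjugate in
theorem hermitianPoint_apply {ι : Type*} {d : ℕ} {e : ι × ι → Fin d} (he : Function.Injective e)
    (z : ι → ℂ) (q : ι × ι) :
    hermitianPoint e z (e q) = (z q.1 * conj (z q.2)).re + (z q.1 * conj (z q.2)).im := by
  simp [hermitianPoint, he.extend_apply]

-- The entries at (i, j) and (j, i) are conjugate, a ± bi, and are recorded as a + b and a - b. This
-- preserves inner products: the mixed real-imaginary terms change sign under transposition and
-- cancel.
open scoped ComplexConjugate in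
theorem inner_hermitianPoint {ι : Type*} [Fintype ι] {d : ℕ} {e : ι × ι → Fin d}
    (he : Function.Injective e) (z w : ι → ℂ) :
    inner ℝ (hermitianPoint e z) (hermitianPoint e w) =
      Complex.normSq (∑ i, z i * conj (w i)) := by
  have h1 : inner ℝ (hermitianPoint e z) (hermitianPoint e w) =
      ∑ q : ι × ι, ((z q.1 * conj (z q.2)).re + (z q.1 * conj (z q.2)).im) *
        ((w q.1 * conj (w q.2)).re + (w q.1 * conj (w q.2)).im) := by
    rw [PiLp.inner_apply]
    symm
    refine Fintype.sum_of_injective e he _ _ (fun k hk => ?_) fun q => ?_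
    · have : hermitianPoint e z k = 0 := by
        simp only [hermitianPoint]
        rw [Function.extend_apply']
        · rfl
        · simpa using hk
      simp [this]
    · rw [hermitianPoint_apply he, hermitianPoint_apply he]
      simp [mul_comm]
  have h2 : Complex.normSq (∑ i, z i * conj (w i)) =
      ∑ q : ι × ι, ((z q.1 * conj (z q.2)).re * (w q.1 * conj (w q.2)).re +
        (z q.1 * conj (z q.2)).im * (w q.1 * conj (w q.2)).im) := by
    have : ((Complex.normSq (∑ i, z i * conj (w i)) : ℝ) : ℂ) =
        ∑ q : ι × ι, (z q.1 * conj (z q.2)) * conj (w q.1 * conj (w q.2)) := by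
      rw [← Complex.mul_conj, map_sum, Finset.sum_mul_sum, Fintype.sum_prod_type]
      refine Finset.sum_congr rfl fun i _ => Finset.sum_congr rfl fun j _ => ?_
      simp only [map_mul, Complex.conj_conj]
      ring
    have := congr_arg Complex.re this
    rw [Complex.ofReal_re, Complex.re_sum] at this
    rw [this]
    refine Finset.sum_congr rfl fun q _ => ?_
    rw [Complex.mul_re, Complex.conj_re, Complex.conj_im]
    ring
  have h3 : ∑ q : ι × ι, ((z q.1 * conj (z q.2)).re * (w q.1 * conj (w q.2)).im +
      (z q.1 * conj (z q.2)).im * (w q.1 * conj (w q.2)).re) = 0 := by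
    have hswap := Fintype.sum_equiv (Equiv.prodComm ι ι)
      (fun q : ι × ι => ((z q.1 * conj (z q.2)).re * (w q.1 * conj (w q.2)).im +
        (z q.1 * conj (z q.2)).im * (w q.1 * conj (w q.2)).re))
      (fun q : ι × ι => -((z q.1 * conj (z q.2)).re * (w q.1 * conj (w q.2)).im +
        (z q.1 * conj (z q.2)).im * (w q.1 * conj (w q.2)).re)) (fun q => by
        simp only [Equiv.prodComm_apply, Prod.fst_swap, Prod.snd_swap, Complex.mul_re,
          Complex.mul_im, Complex.conj_re, Complex.conj_im]
        ring)
    rw [Finset.sum_neg_distrib] at hswap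
    linarith
  rw [h1, h2]
  refine Eq.trans ?_ (add_zero _)
  rw [← h3, ← Finset.sum_add_distrib]
  exact Finset.sum_congr rfl fun q _ => by ring

open scoped ComplexConjugate in
theorem dist_hermitianPoint_sq {ι : Type*} [Fintype ι] {d : ℕ} {e : ι × ι → Fin d}
    (he : Function.Injective e) {z w : ι → ℂ} {m : ℝ} (hz : ∑ i, Complex.normSq (z i) = m)
    (hw : ∑ i, Complex.normSq (w i) = m) :
    dist (hermitianPoint e z) (hermitianPoint e w) ^ 2 =
      2 * m ^ 2 - 2 * Complex.normSq (∑ i, z i * conj (w i)) := by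
  have h : ∀ v : ι → ℂ, ∑ i, Complex.normSq (v i) = m →
      ‖hermitianPoint e v‖ ^ 2 = m ^ 2 := by
    intro v hv
    rw [← real_inner_self_eq_norm_sq, inner_hermitianPoint he]
    simp_rw [Complex.mul_conj]
    rw [← Complex.ofReal_sum, hv, Complex.normSq_ofReal]
    ring
  rw [dist_eq_norm, norm_sub_sq_real, h z hz, h w hw, inner_hermitianPoint he]
  ring

/-- Distinct points of the open upper half of the unit circle. -/
noncomputable def phase (a : ℕ) : ℂ :=
  (a + Complex.I) / (‖(a + Complex.I : ℂ)‖ : ℝ)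

theorem phase_im_pos (a : ℕ) : 0 < (phase a).im := by
  have : (a + Complex.I : ℂ) ≠ 0 := fun h => by simpa using congr_arg Complex.im h
  rw [phase, Complex.div_ofReal_im]
  simpa using this

theorem normSq_phase (a : ℕ) : Complex.normSq (phase a) = 1 := by
  have : (a + Complex.I : ℂ) ≠ 0 := fun h => by simpa using congr_arg Complex.im h
  have : ‖(a + Complex.I : ℂ)‖ ≠ 0 := by simpa using this
  rw [Complex.normSq_eq_norm_sq, phase, norm_div, Complex.norm_real, norm_norm, div_self this,
    one_pow]

theorem phase_injective : Function.Injective phase := by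
  have h : ∀ a, (phase a).re / (phase a).im = a := by
    intro a
    have : (a + Complex.I : ℂ) ≠ 0 := fun h => by simpa using congr_arg Complex.im h
    have : ‖(a + Complex.I : ℂ)‖ ≠ 0 := by simpa using this
    rw [phase, Complex.div_ofReal_im, Complex.div_ofReal_re]
    simp only [Complex.add_re, Complex.natCast_re, Complex.I_re, Complex.add_im,
      Complex.natCast_im, Complex.I_im]
    field_simp
    simp
  intro a b hab
  have := h a
  rw [hab, h b] at this
  exact_mod_cast this.symm

/-- The sign vector `x`, with its nonzero entries rotated by phases and a coordinate `1` added. -/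
noncomputable def rotatedVector {n s r : ℕ} (v : Σ x : signVectors n s, (signSupport x → Fin r)) :
    Option (Fin n) → ℂ
  | none => 1
  | some j => if h : j ∈ signSupport v.1 then (v.1.1 j : ℂ) * phase (v.2 ⟨j, h⟩) else 0

/-- Phases have positive imaginary part, so the sign of the imaginary part of an entry recovers the
sign vector; dividing by it recovers the phase. -/
theorem rotatedVector_injective {n s r : ℕ} :
    Function.Injective (rotatedVector (n := n) (s := s) (r := r)) := by
  rintro ⟨x, τ⟩ ⟨y, ρ⟩ h
  have hj : ∀ j, rotatedVector ⟨x, τ⟩ (some j) = rotatedVector ⟨y, ρ⟩ (some j) :=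
    fun j => congr_fun h _
  simp only [rotatedVector] at hj
  have him : ∀ (x : signVectors n s) (τ : signSupport x → Fin r) (j : Fin n),
      SignType.sign (if h : j ∈ signSupport x then (x.1 j : ℂ) * phase (τ ⟨j, h⟩) else 0).im =
        SignType.sign (x.1 j) := by
    intro x τ j
    split_ifs with h
    · have hp := phase_im_pos (τ ⟨j, h⟩)
      rcases (mem_signVectors.1 x.2).1 j with h' | h' | h' <;> simp [h', hp]
    · have : x.1 j = 0 := by simpa [signSupport] using h
      simp [this]
  obtain rfl : x = y := by
    refine Subtype.ext (funext fun j => ?_)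
    have h1 : SignType.sign (x.1 j) = SignType.sign (y.1 j) := by
      rw [← him x τ j, ← him y ρ j, hj]
    rcases (mem_signVectors.1 x.2).1 j with h | h | h <;>
      rcases (mem_signVectors.1 y.2).1 j with h' | h' | h' <;> simp [h, h'] at h1 ⊢
  congr 1
  funext ⟨j, hjx⟩
  have h1 := hj j
  rw [dif_pos hjx, dif_pos hjx] at h1
  have hx : (x.1 j : ℂ) ≠ 0 := by
    have : x.1 j ≠ 0 := by simpa [signSupport] using hjx
    exact_mod_cast this
  exact Fin.ext (phase_injective (mul_left_cancel₀ hx h1))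

theorem sum_normSq_rotatedVector {n s r : ℕ}
    (v : Σ x : signVectors n s, (signSupport x → Fin r)) :
    ∑ i, Complex.normSq (rotatedVector v i) = 1 + s := by
  rw [Fintype.sum_option, ← Int.cast_natCast s, ← sum_sq_of_mem_signVectors v.1.2, Int.cast_sum]
  congr 1
  · simp [rotatedVector]
  · refine Finset.sum_congr rfl fun j _ => ?_
    simp only [rotatedVector]
    split_ifs with h
    · rw [Complex.normSq_mul, normSq_phase, ← Complex.ofReal_intCast, Complex.normSq_ofReal]
      push_cast
      ring
    · have : v.1.1 j = 0 := by simpa [signSupport] using h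
      simp [this]

open scoped ComplexConjugate in
theorem sum_rotatedVector_mul_conj {n s r : ℕ} (x y : signVectors n s) (θ : Fin n → Fin r) :
    ∑ i, rotatedVector (SimpleGraph.restrictPoint signSupport x θ) i *
      conj (rotatedVector (SimpleGraph.restrictPoint signSupport y θ) i) =
      ((1 + ∑ j, x.1 j * y.1 j : ℤ) : ℂ) := by
  rw [Fintype.sum_option]
  push_cast
  congr 1
  · simp [rotatedVector]
  · refine Finset.sum_congr rfl fun j _ => ?_
    have h0 : ∀ x : signVectors n s, j ∉ signSupport x → (x.1 j : ℂ) = 0 := by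
      intro x h
      have : x.1 j = 0 := by simpa [signSupport] using h
      simp [this]
    have h1 : ∀ x : signVectors n s,
        rotatedVector (SimpleGraph.restrictPoint signSupport x θ) (some j) =
          x.1 j * phase (θ j) := by
      intro x
      by_cases h : j ∈ signSupport x
      · exact dif_pos h
      · rw [h0 x h, zero_mul]
        exact dif_neg h
    have h2 := Complex.mul_conj (phase (θ j))
    rw [normSq_phase] at h2
    rw [h1, h1, map_mul, mul_mul_mul_comm, h2]
    simp

theorem isDiameterGraph_of_adj_restrictPoint {n s r d : ℕ} (hd : (n + 1) ^ 2 ≤ d)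
    {G : SimpleGraph (Σ x : signVectors n s, (signSupport x → Fin r))}
    (hG : ∀ u v, G.Adj u v → ∃ (x y : signVectors n s) (θ : Fin n → Fin r),
      (signGraph n s).Adj x y ∧ u = SimpleGraph.restrictPoint signSupport x θ ∧
      v = SimpleGraph.restrictPoint signSupport y θ) :
    IsDiameterGraph d G := by
  obtain ⟨e⟩ : Nonempty (Option (Fin n) × Option (Fin n) ↪ Fin d) := by
    refine Function.Embedding.nonempty_of_card_le ?_
    simpa [← pow_two] using hd
  refine ⟨fun v => hermitianPoint e (rotatedVector v), fun u v huv => ?_, ?_⟩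
  · refine rotatedVector_injective (funext fun i => ?_)
    have h : ∀ q, hermitianPoint e (rotatedVector u) q = hermitianPoint e (rotatedVector v) q :=
      -- The first coordinate is always 1, so the matrix entries at (i, none) and (none, i) give re
      -- + im and re - im of coordinate i.
      fun q => congr_arg (fun f : EuclideanSpace ℝ (Fin d) => f q) huv
    have h1 := h (e (i, none))
    have h2 := h (e (none, i))
    rw [hermitianPoint_apply e.injective, hermitianPoint_apply e.injective] at h1 h2
    have h3 : ∀ v : Σ x : signVectors n s, (signSupport x → Fin r), rotatedVector v none = 1 :=
      fun _ => rfl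
    simp only [h3, map_one, mul_one, one_mul, Complex.conj_re, Complex.conj_im] at h1 h2
    apply Complex.ext <;> linarith
  · intro u v huv x y
    obtain ⟨a, b, θ, hab, rfl, rfl⟩ := hG u v huv
    refine le_of_sq_le_sq ?_ dist_nonneg
    rw [dist_hermitianPoint_sq e.injective (sum_normSq_rotatedVector _)
        (sum_normSq_rotatedVector _),
      dist_hermitianPoint_sq e.injective (sum_normSq_rotatedVector _)
        (sum_normSq_rotatedVector _), sum_rotatedVector_mul_conj]
    have h0 : ∑ j, a.1 j * b.1 j = -1 := hab
    rw [h0]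
    simp only [add_neg_cancel, Int.cast_zero, map_zero, mul_zero, sub_zero]
    have := Complex.normSq_nonneg
      (∑ i, rotatedVector x i * (starRingEnd ℂ) (rotatedVector y i))
    linarith

/-! ### Numerical estimates. -/

theorem choose_mul_pow_le_succ {N k : ℕ} {w : ℝ} (hw : 0 ≤ w) (hk : k ≤ N)
    (h : (k : ℝ) + 1 ≤ w * (N - k)) :
    (N.choose k : ℝ) * w ^ k ≤ N.choose (k + 1) * w ^ (k + 1) := by
  have h1 : (N.choose (k + 1) : ℝ) * (k + 1) = N.choose k * (N - k) := by
    rw [← Nat.cast_sub hk]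
    exact_mod_cast Nat.choose_succ_right_eq N k
  have h2 : (0 : ℝ) < k + 1 := by positivity
  refine le_of_mul_le_mul_right ?_ h2
  calc (N.choose k : ℝ) * w ^ k * (k + 1) ≤ N.choose k * w ^ k * (w * (N - k)) := by gcongr
    _ = (N.choose k * (N - k)) * w ^ (k + 1) := by ring
    _ = _ := by rw [← h1]; ring

theorem succ_le_choose_mul_pow {N k : ℕ} {w : ℝ} (hw : 0 ≤ w) (hk : k ≤ N)
    (h : w * (N - k) ≤ k + 1) :
    (N.choose (k + 1) : ℝ) * w ^ (k + 1) ≤ N.choose k * w ^ k := by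
  have h1 : (N.choose (k + 1) : ℝ) * (k + 1) = N.choose k * (N - k) := by
    rw [← Nat.cast_sub hk]
    exact_mod_cast Nat.choose_succ_right_eq N k
  have h2 : (0 : ℝ) < k + 1 := by positivity
  refine le_of_mul_le_mul_right ?_ h2
  calc _ = (N.choose (k + 1) : ℝ) * (k + 1) * w ^ (k + 1) := by ring
    _ = N.choose k * w ^ k * (w * (N - k)) := by rw [h1]; ring
    _ ≤ _ := by gcongr

theorem choose_mul_pow_le_of_le {N k l : ℕ} {w : ℝ} (hw : 0 ≤ w) (hkl : k ≤ l) (hl : l ≤ N)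
    (h : (l : ℝ) ≤ w * (N - (l - 1))) :
    (N.choose k : ℝ) * w ^ k ≤ N.choose l * w ^ l := by
  induction l, hkl using Nat.le_induction with
  | base => rfl
  | succ l hkl ih =>
    push_cast at h
    rw [add_sub_cancel_right] at h
    refine (ih (by omega) ?_).trans (choose_mul_pow_le_succ hw (by omega) h)
    nlinarith

theorem le_choose_mul_pow_of_le {N k l : ℕ} {w : ℝ} (hw : 0 ≤ w) (hkl : k ≤ l) (hl : l ≤ N)
    (h : w * (N - k) ≤ k + 1) :
    (N.choose l : ℝ) * w ^ l ≤ N.choose k * w ^ k := by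
  induction l, hkl using Nat.le_induction with
  | base => rfl
  | succ l hkl ih =>
    refine (succ_le_choose_mul_pow hw (by omega) ?_).trans (ih (by omega))
    have : (k : ℝ) ≤ l := by exact_mod_cast hkl
    nlinarith

/-- The binomial expansion of (1/3 + 1) ^ (4a) has 4a + 1 terms, the largest at k = a. -/
theorem pow_le_choose_mul_one_third_pow (a : ℕ) :
    (256 / 81 : ℝ) ^ a ≤ (4 * a + 1) * ((4 * a).choose a * (1 / 3) ^ a) := by
  have h := add_pow (1 / 3 : ℝ) 1 (4 * a)
  have h1 : (1 / 3 + 1 : ℝ) ^ (4 * a) = (256 / 81) ^ a := by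
    rw [pow_mul]
    norm_num
  rw [h1] at h
  rw [h]
  refine le_trans (Finset.sum_le_card_nsmul _ _ (((4 * a).choose a : ℝ) * (1 / 3) ^ a)
    fun k hk => ?_) ?_
  · rw [one_pow, mul_one, mul_comm]
    have hk' : k ≤ 4 * a := by simpa [Nat.lt_succ_iff] using hk
    rcases le_total k a with hka | hka
    · refine choose_mul_pow_le_of_le (by norm_num) hka (by omega) ?_
      push_cast
      linarith
    · refine le_choose_mul_pow_of_le (by norm_num) hka hk' ?_
      push_cast
      linarith
  · rw [Finset.card_range, nsmul_eq_mul]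
    push_cast
    exact le_rfl

/-- The terms are unimodal in s, so on [a, 2a] the minimum is at an end. The bases there are
(256/81) · 1.8 ≈ 5.6889 and 16 · 0.36 = 5.76. -/
theorem pow_le_choose_mul_pow {a s : ℕ} (h1 : a ≤ s) (h2 : s ≤ 2 * a) :
    (5.688 : ℝ) ^ a ≤ (4 * a + 1) * ((4 * a).choose s * 0.6 ^ s) := by
  have ha : (5.688 : ℝ) ^ a ≤ (4 * a + 1) * ((4 * a).choose a * 0.6 ^ a) := by
    calc (5.688 : ℝ) ^ a ≤ (256 / 81 * 1.8) ^ a := by gcongr; norm_num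
      _ = (256 / 81) ^ a * 1.8 ^ a := mul_pow _ _ _
      _ ≤ (4 * a + 1) * ((4 * a).choose a * (1 / 3) ^ a) * 1.8 ^ a := by
        gcongr
        exact pow_le_choose_mul_one_third_pow a
      _ = (4 * a + 1) * ((4 * a).choose a * ((1 / 3) * 1.8) ^ a) := by rw [mul_pow]; ring
      _ = _ := by norm_num
  have h2a : (5.688 : ℝ) ^ a ≤ (4 * a + 1) * ((4 * a).choose (2 * a) * 0.6 ^ (2 * a)) := by
    have h : (4 : ℝ) ^ (2 * a) ≤ (4 * a + 1) * (4 * a).choose (2 * a) := by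
      rcases Nat.eq_zero_or_pos a with rfl | h0
      · simp
      · have := Nat.four_pow_le_two_mul_self_mul_centralBinom (2 * a) (by omega)
        rw [Nat.centralBinom_eq_two_mul_choose, ← mul_assoc, show 2 * 2 * a = 4 * a by ring] at this
        have : ((4 ^ (2 * a) : ℕ) : ℝ) ≤ ((4 * a * (4 * a).choose (2 * a) : ℕ) : ℝ) := by
          exact_mod_cast this
        push_cast at this
        refine this.trans ?_
        gcongr
        linarith
    calc (5.688 : ℝ) ^ a ≤ (4 ^ 2 * 0.6 ^ 2) ^ a := by gcongr; norm_num
      _ = 4 ^ (2 * a) * 0.6 ^ (2 * a) := by rw [mul_pow, ← pow_mul, ← pow_mul]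
      _ ≤ (4 * a + 1) * (4 * a).choose (2 * a) * 0.6 ^ (2 * a) := by gcongr
      _ = _ := by ring
  -- This inequality decides whether s is on the increasing or the decreasing side of the peak.
  by_cases hs : (s : ℝ) ≤ 0.6 * (4 * a - (s - 1))
  · refine ha.trans ?_
    gcongr (4 * (a : ℝ) + 1) * ?_
    refine choose_mul_pow_le_of_le (by norm_num) h1 (by omega) ?_
    push_cast
    exact hs
  · refine h2a.trans ?_
    gcongr (4 * (a : ℝ) + 1) * ?_
    refine le_choose_mul_pow_of_le (by norm_num) h2 (by omega) ?_
    push_cast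
    linarith

theorem pow_le_of_colorable_signGraph {a p K : ℕ} (hp : p.Prime) (hp2 : 3 ≤ p) (hap : a < p)
    (hpa : p ≤ 2 * a) (h : (signGraph (4 * a) (p - 1)).Colorable K) :
    (1.5236 : ℝ) ^ a ≤ (4 * a + 1) * K := by
  have h1 : (((4 * a).choose (p - 1) : ℝ)) * 2 ^ (p - 1) ≤
      K * #(lowExponents (4 * a) (p - 1)) := by
    exact_mod_cast choose_mul_two_pow_le_of_colorable_signGraph hp hp2 h
  -- The choice t = 0.3 turns the factor 2 ^ s into 0.6 ^ s; 1.39 ^ 4 < 3.7331 and 1.5236 · 3.7331 <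
  -- 5.688.
  have h2 := card_lowExponents_mul_pow_le (4 * a) (p - 1) (t := 0.3) (by norm_num) (by norm_num)
  have h3 := pow_le_choose_mul_pow (a := a) (s := p - 1) (by omega) (by omega)
  have h4 : ((4 * a).choose (p - 1) : ℝ) * 0.6 ^ (p - 1) ≤ K * 3.7331 ^ a := by
    calc ((4 * a).choose (p - 1) : ℝ) * 0.6 ^ (p - 1)
        = ((4 * a).choose (p - 1) : ℝ) * 2 ^ (p - 1) * 0.3 ^ (p - 1) := by
          rw [mul_assoc, ← mul_pow]
          norm_num
      _ ≤ K * #(lowExponents (4 * a) (p - 1)) * 0.3 ^ (p - 1) := by gcongr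
      _ = K * (#(lowExponents (4 * a) (p - 1)) * 0.3 ^ (p - 1)) := by ring
      _ ≤ K * (1 + 0.3 + 0.3 ^ 2) ^ (4 * a) := by gcongr
      _ ≤ K * 3.7331 ^ a := by
        rw [pow_mul]
        gcongr
        norm_num
  have h5 : (0 : ℝ) < 3.7331 ^ a := by positivity
  refine le_of_mul_le_mul_right ?_ h5
  calc (1.5236 : ℝ) ^ a * 3.7331 ^ a = (1.5236 * 3.7331) ^ a := (mul_pow _ _ _).symm
    _ ≤ 5.688 ^ a := by gcongr; norm_num
    _ ≤ _ := h3
    _ ≤ (4 * a + 1) * (K * 3.7331 ^ a) := by gcongr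
    _ = _ := by ring

theorem eventually_const_mul_pow_lt :
    ∀ᶠ a : ℕ in Filter.atTop, (4 * a + 1) * (1.107 ^ (4 * a + 5) + 1 : ℝ) < 1.5236 ^ a := by
  have h1 := tendsto_pow_const_mul_const_pow_of_abs_lt_one 1
    (r := 1.107 ^ 4 / 1.5236) (by rw [abs_lt]; constructor <;> norm_num)
  have h2 : Filter.Tendsto (fun a : ℕ => 10 * 1.107 ^ 5 * ((a : ℝ) ^ 1 * (1.107 ^ 4 / 1.5236) ^ a))
      Filter.atTop (nhds 0) := by
    simpa using h1.const_mul (10 * 1.107 ^ 5 : ℝ)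
  filter_upwards [h2.eventually_lt_const one_pos, Filter.eventually_ge_atTop 1] with a ha ha1
  have ha1' : (1 : ℝ) ≤ a := by exact_mod_cast ha1
  have h3 : (1 : ℝ) ≤ 1.107 ^ (4 * a + 5) := one_le_pow₀ (by norm_num)
  have h4 : (0 : ℝ) < 1.5236 ^ a := by positivity
  rw [div_pow, pow_one, ← mul_div_assoc, ← mul_div_assoc, div_lt_one h4] at ha
  calc (4 * a + 1) * (1.107 ^ (4 * a + 5) + 1 : ℝ)
      ≤ (5 * a) * (1.107 ^ (4 * a + 5) + 1.107 ^ (4 * a + 5)) := by gcongr; linarith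
    _ = 10 * 1.107 ^ 5 * (a * (1.107 ^ 4) ^ a) := by rw [pow_add, pow_mul]; ring
    _ < _ := ha

/-! ### Assembling the construction. -/

theorem exists_isDiameterGraph {a d : ℕ} (ha : 2 ≤ a) (hd : (4 * a + 1) ^ 2 ≤ d) (g : ℕ) {K : ℕ}
    (hK : 0 < K) (hKa : (4 * a + 1) * (K : ℝ) < 1.5236 ^ a) :
    ∃ (V : Type) (_ : Finite V) (G : SimpleGraph V),
      IsDiameterGraph d G ∧ (g : ℕ∞) ≤ G.egirth ∧ ¬ G.Colorable K := by
  obtain ⟨p, hp, hap, hpa⟩ := Nat.exists_prime_lt_and_le_two_mul a (by omega)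
  have hp2 : 3 ≤ p := by omega
  have hcol : ¬ (signGraph (4 * a) (p - 1)).Colorable K := fun h =>
    (pow_le_of_colorable_signGraph hp hp2 hap hpa h).not_gt hKa
  obtain ⟨r, G, hG, hg, hGK⟩ := SimpleGraph.exists_sparse_lift (signGraph (4 * a) (p - 1))
    signSupport card_signSupport
    (signSupport_ne_of_adj (hp.even_sub_one (by omega))) hK hcol g
  exact ⟨_, inferInstance, G, isDiameterGraph_of_adj_restrictPoint hd hG, hg, hGK⟩

theorem exists_isDiameterGraph_of_eventually :
    ∃ d₀ : ℕ, ∀ d ≥ d₀, ∀ g : ℕ, ∃ (V : Type) (_ : Finite V) (G : SimpleGraph V) (k : ℕ),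
      IsDiameterGraph d G ∧ (g : ℕ∞) ≤ G.egirth ∧ G.chromaticNumber = (k : ℕ∞) ∧
      (1.107 : ℝ) ^ Real.sqrt (d : ℝ) ≤ (k : ℝ) := by
  obtain ⟨a₀, ha₀⟩ := Filter.eventually_atTop.1 eventually_const_mul_pow_lt
  refine ⟨(4 * (a₀ + 2) + 1) ^ 2, fun d hd g => ?_⟩
  -- The largest a with (4a + 1)² ≤ d; rounding loses at most 4 in the exponent, whence 4a + 5.
  set a := (Nat.sqrt d - 1) / 4 with ha
  have hsq : 4 * (a₀ + 2) + 1 ≤ Nat.sqrt d := Nat.le_sqrt'.2 hd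
  have hda : (4 * a + 1) ^ 2 ≤ d := Nat.le_sqrt'.1 (by omega)
  have had : Real.sqrt d ≤ (4 * a + 5 : ℕ) := by
    rw [Real.sqrt_le_left (by positivity)]
    have : d < (Nat.sqrt d + 1) ^ 2 := Nat.lt_succ_sqrt' d
    have h2 : Nat.sqrt d + 1 ≤ 4 * a + 5 := by omega
    exact_mod_cast this.le.trans (Nat.pow_le_pow_left h2 2)
  set K := ⌈(1.107 : ℝ) ^ (4 * a + 5)⌉₊ with hK
  have hK1 : (1.107 : ℝ) ^ (4 * a + 5) ≤ K := Nat.le_ceil _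
  have hK2 : (K : ℝ) < 1.107 ^ (4 * a + 5) + 1 := Nat.ceil_lt_add_one (by positivity)
  have hK0 : 0 < K := Nat.ceil_pos.2 (by positivity)
  obtain ⟨V, hV, G, hG, hg, hGK⟩ := exists_isDiameterGraph (a := a) (by omega) hda g hK0
    (lt_trans (by gcongr) (ha₀ a (by omega)))
  have := Fintype.ofFinite V
  obtain ⟨k, hk⟩ := ENat.ne_top_iff_exists.1
    (SimpleGraph.chromaticNumber_ne_top_iff_exists.2 ⟨_, G.colorable_of_fintype⟩)
  refine ⟨V, hV, G, k, hG, hg, hk.symm, ?_⟩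
  have hKk : K ≤ k := by
    by_contra! h
    refine hGK (SimpleGraph.chromaticNumber_le_iff_colorable.1 ?_)
    rw [← hk]
    exact_mod_cast h.le
  calc (1.107 : ℝ) ^ Real.sqrt (d : ℝ) ≤ (1.107 : ℝ) ^ (((4 * a + 5 : ℕ)) : ℝ) :=
        Real.rpow_le_rpow_of_exponent_le (by norm_num) had
    _ = 1.107 ^ (4 * a + 5) := Real.rpow_natCast _ _
    _ ≤ K := hK1
    _ ≤ k := by exact_mod_cast hKk

theorem mainTheorem3 :
    ∃ ε : ℕ → ℝ, Filter.Tendsto ε Filter.atTop (nhds 0) ∧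
      ∀ d g : ℕ, ∃ (V : Type) (_ : Finite V) (G : SimpleGraph V) (k : ℕ),
        IsDiameterGraph d G ∧
        (g : ℕ∞) ≤ G.egirth ∧
        G.chromaticNumber = (k : ℕ∞) ∧
        ((1.107 : ℝ) + ε d) ^ Real.sqrt (d : ℝ) ≤ (k : ℝ) := by
  obtain ⟨d₀, h⟩ := exists_isDiameterGraph_of_eventually
  -- In small dimensions the base is lowered to 1, so a single vertex suffices; from d₀ on no
  -- correction is needed.
  refine ⟨fun d => if d₀ ≤ d then 0 else -0.107, ?_, fun d g => ?_⟩
  · refine tendsto_const_nhds.congr' ?_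
    filter_upwards [Filter.eventually_ge_atTop d₀] with d hd
    rw [if_pos hd]
  · dsimp only
    by_cases hd : d₀ ≤ d
    · rw [if_pos hd, add_zero]
      exact h d hd g
    · refine ⟨Unit, inferInstance, ⊥, 1, ⟨fun _ => 0, fun _ _ _ => rfl, by simp⟩, by simp,
        by simp [SimpleGraph.chromaticNumber_bot], ?_⟩
      rw [if_neg hd, show (1.107 : ℝ) + -0.107 = 1 by norm_num, Real.one_rpow, Nat.cast_one]
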